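/- An effect algebra is a set $E$ with elements $0,1$ and a partial binary operation $+$ such that: (E1) if $a+b$ is defined then so is $b+a$, and $a+b=b+a$; (E2) if $a+b$ and $(a+b)+c$ are defined then so are $b+c$ and $a+(b+c)$, and $(a+b)+c=a+(b+c)$; (E3) for each $a$ there is a unique $a'$ such that $a+a'$ is defined and equal to $1$; (E4) if $a+1$ is defined then $a=0$. It is partially ordered by $a\le b$ iff $c+a=b$ for some $c\in E$. It is atomic if below every nonzero element there is an atom (a minimal nonzero element). It has the Riesz decomposition property (RDP) if $a_1+a_2=b_1+b_2$ implies that there are $c_{11},c_{12},c_{21},c_{22}\in E$ with $a_i=c_{i1}+c_{i2}$ and $b_j=c_{1j}+c_{2j}$ for $i,j\in\{1,2\}$. A system $(x_i)_{i\in J}$ in $E$ is orthogonal if $\sum_{i\in F}x_i$ is defined for every finite $F\subseteq J$; its sum $\sum_{i\in J}x_i$ is then $\bigvee\{\sum_{i\in F}x_i : F\subseteq J \text{ finite}\}$, if this supremum exists. $E$ is $\sigma$-orthocomplete if every countable orthogonal system has a sum. The isotropic index of $a$ is the largest $n\ge 0$ such that the $n$-fold sum $na$ is defined ($+\infty$ if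 there is no largest one). An element $z$ is central if each of $[0,z]$ and $[0,z']$ is closed under existing sums and every $x\in E$ is of the form $x=x_1+x_2$ with $x_1\le z$, $x_2\le z'$; the set $C(E)$ of central elements, with the order of $E$, is the center. For $e\in E$ the interval $E[0,e]=\{x\in E: 0\le x\le e\}$ is an effect algebra with unit $e$, where $x+y$ is defined iff it is defined in $E$ and is $\le e$. The operation of a product of effect algebras is coordinatewise, and a sum is defined there iff it is defined in every coordinate. Elements $a,b$ are compatible if $a=a_1+c$, $b=b_1+c$ for some $a_1,b_1,c$ such that $a_1+b_1+c$ is defined. An MV-effect algebra is a lattice-ordered effect algebra in which any two elements are compatible; it is $\sigma$-complete if every countable subset has a supremum and an infimum. Theorem. Let $E$ be a $\sigma$-orthocomplete atomic effect algebra with RDP whose set of atoms $\{a_i : i\in I\}$ (indexed without repetition) is at most countable, and let $\imath_i$ be the isotropic index of $a_i$. Then every $\imath_i$ is finite, every interval $E[0,\imath_ia_i]$ is a finite chain, and: (i) for every $i\in I$ the element $\imath_i a_i$ is central; (ii) for every $i\in I$ the element $\imath_i a_i$ is an atom of $C(E)$; (iii) for every $y\in E$ the meets $y\wedge \imath_i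 a_i$ exist, they form an orthogonal system, and $y=\sum_{i\in I}(y\wedge \imath_i a_i)$; (iv) $E$ is isomorphic, as an effect algebra, to the product $\prod_{i\in I}E[0,\imath_i a_i]$; (v) $E$ is a $\sigma$-complete MV-effect algebra. -/

import Mathlib

universe u v w

/-- An effect algebra: a set with two constants `0`, `1` and a partial binary operation `oplus`.
`c ∈ oplus a b` means that `a + b` is defined and equal to `c`. -/
class EffectAlgebra (E : Type u) extends Zero E, One E where
  /-- the partial addition -/
  oplus : E → E → Part E
  oplus_comm : ∀ {a b c : E}, c ∈ oplus a b → c ∈ oplus b a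
  oplus_assoc : ∀ {a b c d f : E}, d ∈ oplus a b → f ∈ oplus d c →
    ∃ g, g ∈ oplus b c ∧ f ∈ oplus a g
  existsUnique_compl : ∀ a : E, ∃! b : E, (1 : E) ∈ oplus a b
  eq_zero_of_dom : ∀ {a : E}, (oplus a 1).Dom → a = 0

namespace EffectAlgebra

section Basic

variable {E : Type u} [EffectAlgebra E]

theorem oplus_assoc' {a b c g f : E} (h1 : g ∈ oplus b c) (h2 : f ∈ oplus a g) :
    ∃ d, d ∈ oplus a b ∧ f ∈ oplus d c := by
  obtain ⟨d, hd, hf⟩ := oplus_assoc (oplus_comm h1) (oplus_comm h2)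
  exact ⟨d, oplus_comm hd, oplus_comm hf⟩

theorem eq_zero_of_mem {a t : E} (h : t ∈ oplus a 1) : a = 0 :=
  eq_zero_of_dom (Part.dom_iff_mem.2 ⟨t, h⟩)

theorem oplus_zero (a : E) : a ∈ oplus a 0 := by
  obtain ⟨b, hb, -⟩ := existsUnique_compl (1 : E)
  have hb0 : b = 0 := eq_zero_of_mem (oplus_comm hb)
  subst hb0
  obtain ⟨a', ha', -⟩ := existsUnique_compl a
  obtain ⟨g, hg, h1⟩ := oplus_assoc (oplus_comm ha') hb
  have : g = a := (existsUnique_compl a').unique h1 (oplus_comm ha')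
  exact this ▸ hg

theorem zero_oplus (a : E) : a ∈ oplus 0 a := oplus_comm (oplus_zero a)

theorem oplus_cancel {a b d c : E} (h1 : c ∈ oplus a b) (h2 : c ∈ oplus a d) : b = d := by
  obtain ⟨c', hc', -⟩ := existsUnique_compl c
  obtain ⟨f, hf, hf1⟩ := oplus_assoc h1 hc'
  obtain ⟨g, hg, hg1⟩ := oplus_assoc h2 hc'
  have hfg : f = g := (existsUnique_compl a).unique hf1 hg1
  subst hfg
  obtain ⟨p, hp, hp1⟩ := oplus_assoc hf (oplus_comm hf1)
  obtain ⟨q, hq, hq1⟩ := oplus_assoc hg (oplus_comm hf1)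
  have hpq : p = q := Part.mem_unique hp hq
  subst hpq
  exact (existsUnique_compl p).unique (oplus_comm hp1) (oplus_comm hq1)

theorem eq_zero_of_oplus_eq_zero {c d : E} (h : (0 : E) ∈ oplus c d) : c = 0 := by
  obtain ⟨g, hg, -⟩ := oplus_assoc (oplus_comm h) (zero_oplus (1 : E))
  exact eq_zero_of_mem hg

/-- `a ≤ b` iff `c + a = b` for some `c`. -/
instance instPartialOrder : PartialOrder E where
  le a b := ∃ c : E, b ∈ oplus c a
  le_refl a := ⟨0, zero_oplus a⟩
  le_trans a b c := by
    rintro ⟨d, hd⟩ ⟨f, hf⟩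
    obtain ⟨g, -, hg⟩ := oplus_assoc' hd hf
    exact ⟨g, hg⟩
  le_antisymm a b := by
    rintro ⟨c, hc⟩ ⟨d, hd⟩
    obtain ⟨g, hg, hb⟩ := oplus_assoc' hd hc
    have hg0 : g = 0 := oplus_cancel (oplus_comm hb) (oplus_zero b)
    subst hg0
    have : c = 0 := eq_zero_of_oplus_eq_zero hg
    subst this
    exact Part.mem_unique (zero_oplus a) hc

theorem le_def {a b : E} : a ≤ b ↔ ∃ c : E, b ∈ oplus c a := Iff.rfl

instance instBoundedOrder : BoundedOrder E where
  bot := 0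
  bot_le a := ⟨a, oplus_zero a⟩
  top := 1
  le_top a := by
    obtain ⟨b, hb, -⟩ := existsUnique_compl a
    exact ⟨b, oplus_comm hb⟩

theorem zero_le' (a : E) : (0 : E) ≤ a := ⟨a, oplus_zero a⟩

theorem le_of_oplus_left {a b c : E} (h : c ∈ oplus a b) : a ≤ c := ⟨b, oplus_comm h⟩

theorem le_of_oplus_right {a b c : E} (h : c ∈ oplus a b) : b ≤ c := ⟨a, h⟩

/-- The orthosupplement: the unique `b` with `a + b = 1`. -/
noncomputable def compl (a : E) : E := (existsUnique_compl a).choose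

theorem oplus_compl (a : E) : (1 : E) ∈ oplus a (compl a) :=
  (existsUnique_compl a).choose_spec.1

/-- The partial multiple `n a`. -/
def multiple : ℕ → E → Part E
  | 0, _ => Part.some 0
  | n + 1, a => (multiple n a).bind fun b => oplus b a

/-- The isotropic index: the largest `n` such that `n a` exists, and `⊤` if `n a` exists for
every `n`. -/
noncomputable def isotropicIndex (a : E) : ℕ∞ :=
  ⨆ n ∈ {n : ℕ | (multiple n a).Dom}, (n : ℕ∞)

/-- Adding `a` to a possibly undefined element. -/
def addTo (a : E) (p : Part E) : Part E := p.bind fun b => oplus a b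

instance instLeftCommutative : LeftCommutative (addTo (E := E)) where
  left_comm a b p := by
    have key : ∀ (a b t : E), t ∈ addTo a (addTo b p) → t ∈ addTo b (addTo a p) := by
      intro a b t ht
      simp only [addTo, Part.mem_bind_iff] at ht ⊢
      obtain ⟨s, ⟨r, hr, hs⟩, ht⟩ := ht
      obtain ⟨d, hd, ht'⟩ := oplus_assoc' hs ht
      obtain ⟨g, hg, h⟩ := oplus_assoc (oplus_comm hd) ht'
      exact ⟨g, ⟨r, hr, hg⟩, h⟩
    exact Part.ext fun t => ⟨key a b t, key b a t⟩

/-- The partial sum of the finite subsystem of `x` indexed by `F`. -/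
def finSum {ι : Type w} (x : ι → E) (F : Finset ι) : Part E :=
  (F.val.map x).foldr addTo (Part.some 0)

/-- A system is orthogonal if all its finite subsystems have a sum. -/
def Orthogonal {ι : Type w} (x : ι → E) : Prop := ∀ F : Finset ι, (finSum x F).Dom

/-- `s` is the sum of the orthogonal system `x`: the supremum of the sums of its finite
subsystems. -/
def IsOrthoSum {ι : Type w} (x : ι → E) (s : E) : Prop :=
  Orthogonal x ∧ IsLUB {t : E | ∃ F : Finset ι, t ∈ finSum x F} s

/-- `z` is principal: the interval `[0, z]` is closed under existing sums. -/
def IsPrincipal (z : E) : Prop := ∀ ⦃x y t : E⦄, x ≤ z → y ≤ z → t ∈ oplus x y → t ≤ z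

/-- `z` is central: `z` and its orthosupplement are principal, and every element decomposes as
a sum of an element below `z` and an element below the orthosupplement. Equivalently,
`x = x₁ + x₂ ↦ (x₁, x₂)` identifies the algebra with `[0, z] × [0, z']`. -/
def IsCentral (z : E) : Prop :=
  IsPrincipal z ∧ IsPrincipal (compl z) ∧
    ∀ x : E, ∃ x₁ x₂ : E, x₁ ≤ z ∧ x₂ ≤ compl z ∧ x ∈ oplus x₁ x₂

variable (E) in
/-- The center `C(E)`, ordered by the order of `E`. -/
def center : Set E := {z : E | IsCentral z}

theorem isCentral_zero : IsCentral (0 : E) := by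
  have hc : compl (0 : E) = 1 := oplus_cancel (oplus_compl 0) (zero_oplus 1)
  refine ⟨?_, ?_, ?_⟩
  · intro x y t hx hy ht
    have hx0 : x = 0 := le_antisymm hx (zero_le' x)
    subst hx0
    exact Part.mem_unique ht (zero_oplus y) ▸ hy
  · intro x y t _ _ _
    rw [hc]
    exact le_top (a := t)
  · intro x
    exact ⟨0, x, le_refl _, hc ▸ le_top (a := x), zero_oplus x⟩

instance instOrderBotCenter : OrderBot (center E) where
  bot := ⟨0, isCentral_zero⟩
  bot_le a := zero_le' a.1

variable (E) in
/-- Riesz decomposition property. -/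
def RDP : Prop := ∀ a₁ a₂ b₁ b₂ s : E, s ∈ oplus a₁ a₂ → s ∈ oplus b₁ b₂ →
  ∃ c₁₁ c₁₂ c₂₁ c₂₂ : E, a₁ ∈ oplus c₁₁ c₁₂ ∧ a₂ ∈ oplus c₂₁ c₂₂ ∧
    b₁ ∈ oplus c₁₁ c₂₁ ∧ b₂ ∈ oplus c₁₂ c₂₂

variable (E) in
/-- Every countable orthogonal system has a sum. -/
def SigmaOrthocomplete : Prop :=
  ∀ (ι : Type) [Countable ι] (x : ι → E), Orthogonal x → ∃ s : E, IsOrthoSum x s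

/-- `a = a₁ + c`, `b = b₁ + c` with `a₁ + b₁ + c` defined. -/
def Compatible (a b : E) : Prop :=
  ∃ a₁ b₁ c d : E, a ∈ oplus a₁ c ∧ b ∈ oplus b₁ c ∧ d ∈ oplus a₁ b₁ ∧ (oplus d c).Dom

variable (E) in
/-- Lattice-ordered, with all pairs of elements compatible. -/
def IsMVEffectAlgebra : Prop :=
  (∀ a b : E, (∃ s, IsLUB {a, b} s) ∧ ∃ m, IsGLB {a, b} m) ∧ ∀ a b : E, Compatible a b

variable (E) in
/-- An MV-effect algebra in which all countable subsets have suprema and infima. -/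
def IsSigmaCompleteMVEffectAlgebra : Prop :=
  IsMVEffectAlgebra E ∧
    ∀ S : Set E, S.Countable → (∃ s, IsLUB S s) ∧ ∃ m, IsGLB S m

/-- The interval `E[0, e]`. -/
@[ext]
structure Interval (e : E) : Type u where
  val : E
  zero_le_val : 0 ≤ val
  val_le : val ≤ e

/-- `E[0, e]` as an effect algebra with unit `e`: a sum is defined in it iff it is defined in `E`
and lies below `e`. -/
instance instInterval (e : E) : EffectAlgebra (Interval e) where
  zero := ⟨0, le_refl _, zero_le' e⟩
  one := ⟨e, zero_le' e, le_refl _⟩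
  oplus a b :=
    ⟨∃ h : (oplus a.1 b.1).Dom, (oplus a.1 b.1).get h ≤ e,
      fun h => ⟨(oplus a.1 b.1).get h.1, zero_le' _, h.2⟩⟩
  oplus_comm := by
    rintro a b c ⟨⟨h, he⟩, rfl⟩
    have hm := oplus_comm (Part.get_mem h)
    obtain ⟨h', h''⟩ := hm
    exact ⟨⟨h', h''.symm ▸ he⟩, Interval.ext h''⟩
  oplus_assoc := by
    rintro a b c d f ⟨⟨h, he⟩, rfl⟩ ⟨⟨h2, he2⟩, rfl⟩
    obtain ⟨g, hg, hf⟩ := oplus_assoc (Part.get_mem h) (Part.get_mem h2)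
    have hge : g ≤ e := le_trans (le_of_oplus_right hf) he2
    obtain ⟨k, hk⟩ := hg
    obtain ⟨l, hl⟩ := hf
    exact ⟨⟨g, zero_le' g, hge⟩, ⟨⟨k, hk.symm ▸ hge⟩, Interval.ext hk⟩,
      ⟨⟨l, hl.symm ▸ he2⟩, Interval.ext hl⟩⟩
  existsUnique_compl := by
    rintro ⟨a, ha0, c, hc⟩
    refine ⟨⟨c, zero_le' c, le_of_oplus_left hc⟩, ?_, ?_⟩
    · obtain ⟨k, hk⟩ := oplus_comm hc
      exact ⟨⟨k, le_of_eq hk⟩, Interval.ext hk⟩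
    · rintro ⟨b, hb0, hb⟩ ⟨⟨k, hk⟩, h⟩
      exact Interval.ext (oplus_cancel ⟨k, congrArg Interval.val h⟩ (oplus_comm hc))
  eq_zero_of_dom := by
    rintro ⟨a, ha0, ha⟩ ⟨k, hk⟩
    have hm := Part.get_mem k
    have heq : (oplus a e).get k = e := le_antisymm hk (le_of_oplus_right hm)
    have hm' : e ∈ oplus a e := ⟨k, heq⟩
    exact Interval.ext (oplus_cancel (oplus_comm hm') (oplus_zero e))

end Basic

/-- The product of a family of sets, carrying the coordinatewise effect algebra structure. -/
def Product {I : Type v} (F : I → Type u) : Type (max v u) := ∀ i, F i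

instance instProduct {I : Type v} (F : I → Type u) [∀ i, EffectAlgebra (F i)] :
    EffectAlgebra (Product F) where
  zero := fun _ => 0
  one := fun _ => 1
  oplus a b :=
    ⟨∀ i, (oplus (a i) (b i)).Dom, fun h i => (oplus (a i) (b i)).get (h i)⟩
  oplus_comm := by
    rintro a b c ⟨h, rfl⟩
    have hm := fun i => oplus_comm (Part.get_mem (h i))
    exact ⟨fun i => (hm i).1, funext fun i => (hm i).2⟩
  oplus_assoc := by
    rintro a b c d f ⟨h, rfl⟩ ⟨h2, rfl⟩
    choose g hg hf using fun i => oplus_assoc (Part.get_mem (h i)) (Part.get_mem (h2 i))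
    exact ⟨g, ⟨fun i => (hg i).1, funext fun i => (hg i).2⟩,
      ⟨fun i => (hf i).1, funext fun i => (hf i).2⟩⟩
  existsUnique_compl := by
    intro a
    refine ⟨fun i => compl (a i), ?_, ?_⟩
    · exact ⟨fun i => (oplus_compl (a i)).1, funext fun i => (oplus_compl (a i)).2⟩
    · rintro b ⟨h, hb⟩
      exact funext fun i => oplus_cancel (⟨h i, congrFun hb i⟩ : (1 : F i) ∈ oplus (a i) (b i))
        (oplus_compl (a i))
  eq_zero_of_dom := by
    intro a h
    exact funext fun i => eq_zero_of_dom (h i)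

/-- An isomorphism of effect algebras: a bijection preserving `0` and `1`, such that `a + b` is
defined iff the sum of the images is, and then the sums correspond. -/
structure Iso (E : Type u) (F : Type v) [EffectAlgebra E] [EffectAlgebra F] extends E ≃ F where
  map_zero : toFun 0 = 0
  map_one : toFun 1 = 1
  map_oplus : ∀ a b c : E, c ∈ oplus a b ↔ toFun c ∈ oplus (toFun a) (toFun b)

end EffectAlgebra

/-! An atom `a` has only finitely many multiples: a supremum `s = r + a` of all of them would
already be bounded by `r`. Let `e` be the greatest one. By RDP everything below `e` is a multiple of
`a`, so `[0, e]` is a finite chain, and an element not above `a` meets `e` only in `0`, hence lies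
below `e'`. This makes `e` central (`IsMaxMultiple.isCentral`) and the `e i` pairwise orthogonal; by
atomicity only `0` is orthogonal to all of them.

Meeting with a central element is additive (`IsCentral.meet_oplus`). Families `u i ≤ e i` have
suprema by σ-orthocompleteness; each `y` is the supremum of its components (`isLUB_comp`), and the
supremum of such a family has components `u i` (`comp_eq_of_isLUB`). So `E` is the product of the
chains, where suprema are coordinatewise maxima. Compatibility is a direct consequence of RDP. -/

namespace EffectAlgebra

section General

variable {E : Type u} [EffectAlgebra E]

/-! ### Order and orthogonality -/

theorem exists_oplus_le {x y z t : E} (h : x ≤ y) (ht : t ∈ oplus z y) :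
    ∃ t', t' ∈ oplus z x ∧ t' ≤ t := by
  obtain ⟨c, hc⟩ := h
  obtain ⟨d, hd, hdt⟩ := oplus_assoc' (oplus_comm hc) ht
  exact ⟨d, hd, le_of_oplus_left hdt⟩

theorem le_compl_of_mem {x z t : E} (ht : t ∈ oplus z x) : x ≤ compl z := by
  obtain ⟨g, hg, h⟩ := oplus_assoc ht (oplus_compl t)
  rw [oplus_cancel (oplus_compl z) h]
  exact le_of_oplus_left hg

theorem exists_mem_of_le_compl {x z : E} (h : x ≤ compl z) : ∃ t, t ∈ oplus z x := by
  obtain ⟨t, ht, -⟩ := exists_oplus_le h (oplus_compl z)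
  exact ⟨t, ht⟩

theorem le_compl_symm {x z : E} (h : x ≤ compl z) : z ≤ compl x := by
  obtain ⟨t, ht⟩ := exists_mem_of_le_compl h
  exact le_compl_of_mem (oplus_comm ht)

theorem le_zero_eq {x : E} (h : x ≤ 0) : x = 0 := le_antisymm h (zero_le' x)

theorem eq_of_oplus_zero {x t : E} (h : t ∈ oplus x 0) : t = x :=
  Part.mem_unique h (oplus_zero x)

theorem eq_of_zero_oplus {x t : E} (h : t ∈ oplus 0 x) : t = x :=
  Part.mem_unique h (zero_oplus x)

theorem eq_zero_of_oplus_le {x y t : E} (h : t ∈ oplus x y) (hle : t ≤ x) : y = 0 := by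
  rw [le_antisymm hle (le_of_oplus_left h)] at h
  exact oplus_cancel h (oplus_zero x)

theorem le_of_oplus_le_oplus {x y z s t : E} (hs : s ∈ oplus z x) (ht : t ∈ oplus z y)
    (h : s ≤ t) : x ≤ y := by
  obtain ⟨c, hc⟩ := h
  obtain ⟨g, hg, hgt⟩ := oplus_assoc hs (oplus_comm hc)
  rw [oplus_cancel ht hgt]
  exact le_of_oplus_left hg

theorem oplus_le_oplus {x y z s t : E} (hs : s ∈ oplus z x) (ht : t ∈ oplus z y)
    (h : x ≤ y) : s ≤ t := by
  obtain ⟨t', ht', hle⟩ := exists_oplus_le h ht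
  rwa [Part.mem_unique hs ht']

/-! ### Riesz decomposition -/

theorem RDP.exists_decomp (hR : RDP E) {x s p q : E} (h : x ≤ s) (hs : s ∈ oplus p q) :
    ∃ x₁ x₂, x ∈ oplus x₁ x₂ ∧ x₁ ≤ p ∧ x₂ ≤ q := by
  obtain ⟨c, hc⟩ := h
  obtain ⟨c₁, c₂, c₃, c₄, h1, -, h3, h4⟩ := hR _ _ _ _ s (oplus_comm hc) hs
  exact ⟨c₁, c₂, h1, le_of_oplus_left h3, le_of_oplus_left h4⟩

/-- The `p`-part of `x` lies below both `x` and `p`, so it vanishes. -/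
theorem RDP.le_right_of_disjoint (hR : RDP E) {x s p q : E} (h : x ≤ s) (hs : s ∈ oplus p q)
    (hd : ∀ w, w ≤ x → w ≤ p → w = 0) : x ≤ q := by
  obtain ⟨x₁, x₂, hx, h1, h2⟩ := hR.exists_decomp h hs
  obtain rfl := hd x₁ (le_of_oplus_left hx) h1
  rwa [eq_of_zero_oplus hx]

theorem RDP.compatible (hR : RDP E) (a b : E) : Compatible a b := by
  obtain ⟨c₁₁, c₁₂, c₂₁, c₂₂, h1, h2, h3, -⟩ := hR _ _ _ _ 1 (oplus_compl a) (oplus_compl b)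
  -- Of the refinement of `1 = a + a' = b + b'`, the sum `c₁₁ + c₁₂ + c₂₁` witnesses compatibility,
  -- with common part `c₁₁`.
  obtain ⟨t, ht, -⟩ := exists_oplus_le (le_of_oplus_left h2) (oplus_compl a)
  obtain ⟨g, hg, htg⟩ := oplus_assoc h1 ht
  exact ⟨c₁₂, c₂₁, c₁₁, g, oplus_comm h1, oplus_comm h3, hg,
    Part.dom_iff_mem.2 ⟨t, oplus_comm htg⟩⟩

/-! ### Central elements and their meets -/

theorem IsPrincipal.eq_zero {z w : E} (hz : IsPrincipal z) (h1 : w ≤ z) (h2 : w ≤ compl z) :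
    w = 0 := by
  obtain ⟨t, ht⟩ := exists_mem_of_le_compl h2
  exact eq_zero_of_oplus_le ht (hz le_rfl h1 ht)

/-- In `x = u + r`, `v` is disjoint from `u`, so `v ≤ r`. -/
theorem IsPrincipal.oplus_le (hR : RDP E) {z u v x t : E} (hz : IsPrincipal z) (hu : u ≤ z)
    (hv : v ≤ compl z) (hux : u ≤ x) (hvx : v ≤ x) (ht : t ∈ oplus u v) : t ≤ x := by
  obtain ⟨r, hr⟩ := hux
  refine oplus_le_oplus ht (oplus_comm hr) (hR.le_right_of_disjoint hvx (oplus_comm hr) ?_)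
  exact fun w h1 h2 => hz.eq_zero (h2.trans hu) (h1.trans hv)

theorem IsCentral.isGLB (hR : RDP E) {z x x₁ x₂ : E} (hz : IsCentral z) (h1 : x₁ ≤ z)
    (h2 : x₂ ≤ compl z) (hx : x ∈ oplus x₁ x₂) : IsGLB {x, z} x₁ := by
  constructor
  · rintro y (rfl | rfl)
    exacts [le_of_oplus_left hx, h1]
  · intro w hw
    refine hR.le_right_of_disjoint (hw (by simp)) (oplus_comm hx) fun v hv hv2 => ?_
    exact hz.1.eq_zero (hv.trans (hw (by simp))) (hv2.trans h2)

/-- The meet of `x` with a central element. -/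
noncomputable def IsCentral.meet {z : E} (hz : IsCentral z) (x : E) : E := (hz.2.2 x).choose

theorem IsCentral.exists_meet {z : E} (hz : IsCentral z) (x : E) :
    ∃ x₂, hz.meet x ≤ z ∧ x₂ ≤ compl z ∧ x ∈ oplus (hz.meet x) x₂ :=
  (hz.2.2 x).choose_spec

theorem IsCentral.meet_le_right {z : E} (hz : IsCentral z) (x : E) : hz.meet x ≤ z := by
  obtain ⟨_, h, -⟩ := hz.exists_meet x
  exact h

theorem IsCentral.meet_le_left {z : E} (hz : IsCentral z) (x : E) : hz.meet x ≤ x := by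
  obtain ⟨_, -, -, h⟩ := hz.exists_meet x
  exact le_of_oplus_left h

theorem IsCentral.isGLB_meet (hR : RDP E) {z : E} (hz : IsCentral z) (x : E) :
    IsGLB {x, z} (hz.meet x) := by
  obtain ⟨x₂, h1, h2, h⟩ := hz.exists_meet x
  exact hz.isGLB hR h1 h2 h

theorem IsCentral.le_meet (hR : RDP E) {z w x : E} (hz : IsCentral z) (h1 : w ≤ x)
    (h2 : w ≤ z) : w ≤ hz.meet x :=
  (hz.isGLB_meet hR x).2 (by rintro y (rfl | rfl) <;> assumption)

theorem IsCentral.meet_mono (hR : RDP E) {z x y : E} (hz : IsCentral z) (h : x ≤ y) :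
    hz.meet x ≤ hz.meet y :=
  hz.le_meet hR ((hz.meet_le_left x).trans h) (hz.meet_le_right x)

theorem IsCentral.meet_eq (hR : RDP E) {z x x₁ x₂ : E} (hz : IsCentral z) (h1 : x₁ ≤ z)
    (h2 : x₂ ≤ compl z) (hx : x ∈ oplus x₁ x₂) : hz.meet x = x₁ :=
  (hz.isGLB_meet hR x).unique (hz.isGLB hR h1 h2 hx)

theorem oplus_oplus_oplus_comm {x y t x₁ x₂ y₁ y₂ : E} (hx : x ∈ oplus x₁ x₂)
    (hy : y ∈ oplus y₁ y₂) (ht : t ∈ oplus x y) :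
    ∃ s₁ s₂, s₁ ∈ oplus x₁ y₁ ∧ s₂ ∈ oplus x₂ y₂ ∧ t ∈ oplus s₁ s₂ := by
  obtain ⟨p, hp, htp⟩ := oplus_assoc hx ht
  obtain ⟨q, hq, hpq⟩ := oplus_assoc' hy hp
  obtain ⟨r, hr, hpr⟩ := oplus_assoc (oplus_comm hq) hpq
  obtain ⟨s, hs, hts⟩ := oplus_assoc' hpr htp
  exact ⟨s, r, hs, hr, hts⟩

/-- Both `z` and `z'` are principal, so adding the parts of `x` and `y` separately gives the
decomposition of `t`. -/
theorem IsCentral.meet_oplus (hR : RDP E) {z x y t : E} (hz : IsCentral z)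
    (ht : t ∈ oplus x y) : hz.meet t ∈ oplus (hz.meet x) (hz.meet y) := by
  obtain ⟨x₂, hx1, hx2, hx⟩ := hz.exists_meet x
  obtain ⟨y₂, hy1, hy2, hy⟩ := hz.exists_meet y
  obtain ⟨s₁, s₂, h1, h2, h⟩ := oplus_oplus_oplus_comm hx hy ht
  rwa [hz.meet_eq hR (hz.1 hx1 hy1 h1) (hz.2.1 hx2 hy2 h2) h]

/-! ### Finite and countable orthogonal sums -/

theorem finSum_insert {ι : Type w} [DecidableEq ι] (x : ι → E) {i : ι} {F : Finset ι}
    (h : i ∉ F) : finSum x (insert i F) = addTo (x i) (finSum x F) := by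
  simp [finSum, Finset.insert_val_of_notMem h]

theorem mem_finSum_insert {ι : Type w} [DecidableEq ι] {x : ι → E} {i : ι} {F : Finset ι}
    (h : i ∉ F) {t : E} : t ∈ finSum x (insert i F) ↔ ∃ s ∈ finSum x F, t ∈ oplus (x i) s := by
  simp [finSum_insert x h, addTo]

theorem finSum_singleton {ι : Type w} (x : ι → E) (i : ι) : x i ∈ finSum x {i} := by
  simpa [finSum, addTo] using oplus_zero (x i)

theorem finSum_map {ι : Type w} {κ : Type v} (g : κ ↪ ι) (x : ι → E) (F : Finset κ) :
    finSum (x ∘ g) F = finSum x (F.map g) := by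
  simp [finSum]

theorem finSum_const {ι : Type w} (a : E) (F : Finset ι) :
    finSum (fun _ : ι => a) F = multiple F.card a := by
  classical
  induction F using Finset.induction_on with
  | empty => rfl
  | insert i F hi ih =>
    rw [finSum_insert _ hi, ih, Finset.card_insert_of_notMem hi]
    refine Part.ext fun t => ?_
    simp only [addTo, multiple, Part.mem_bind_iff]
    exact exists_congr fun s => and_congr_right fun _ => ⟨oplus_comm, oplus_comm⟩

/-- Moves the index set, which may live in any universe, to a subset of `ℕ`. -/
theorem SigmaOrthocomplete.exists_isOrthoSum (hσ : SigmaOrthocomplete E) {I : Type v}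
    [Countable I] (x : I → E) (hx : Orthogonal x) : ∃ s, IsOrthoSum x s := by
  obtain ⟨f, hf⟩ := exists_injective_nat I
  let g : Set.range f ≃ I := (Equiv.ofInjective f hf).symm
  obtain ⟨s, -, hs⟩ := hσ (Set.range f) (x ∘ g.toEmbedding) fun F => by
    rw [finSum_map]
    exact hx _
  refine ⟨s, hx, ?_⟩
  convert hs using 3
  next t =>
  constructor
  · rintro ⟨F, hF⟩
    refine ⟨F.map g.symm.toEmbedding, ?_⟩
    rw [finSum_map, Finset.map_map]
    convert hF
    ext i
    simp
  · rintro ⟨F, hF⟩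
    exact ⟨_, finSum_map g.toEmbedding x F ▸ hF⟩

/-! ### Sums in intervals and products -/

theorem Interval.mem_oplus_iff {z : E} {x y t : Interval z} :
    t ∈ oplus x y ↔ t.val ∈ oplus x.val y.val := by
  constructor
  · rintro ⟨⟨h, h'⟩, rfl⟩
    exact Part.get_mem h
  · rintro ⟨h, h'⟩
    exact ⟨⟨h, h'.symm ▸ t.val_le⟩, Interval.ext h'⟩

theorem Product.mem_oplus_iff {F : I → Type u}
    [∀ i, EffectAlgebra (F i)] {x y t : Product F} :
    t ∈ oplus x y ↔ ∀ i, t i ∈ oplus (x i) (y i) := by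
  constructor
  · rintro ⟨h, rfl⟩ i
    exact Part.get_mem (h i)
  · intro h
    exact ⟨fun i => (h i).1, funext fun i => (h i).2⟩

end General

/-! ### Multiples of an atom -/

section Multiples

variable {E : Type u} [EffectAlgebra E] {a : E}

theorem mem_multiple_succ {n : ℕ} {t : E} :
    t ∈ multiple (n + 1) a ↔ ∃ s ∈ multiple n a, t ∈ oplus s a := by
  simp [multiple]

theorem mem_multiple_one : a ∈ multiple 1 a :=
  mem_multiple_succ.2 ⟨0, Part.mem_some 0, zero_oplus a⟩

theorem exists_mem_multiple_of_le {m n : ℕ} (h : m ≤ n) {t : E} (ht : t ∈ multiple n a) :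
    ∃ s ∈ multiple m a, s ≤ t := by
  induction n, h using Nat.le_induction generalizing t with
  | base => exact ⟨t, ht, le_rfl⟩
  | succ n _ ih =>
    obtain ⟨r, hr, hrt⟩ := mem_multiple_succ.1 ht
    obtain ⟨s, hs, hsr⟩ := ih hr
    exact ⟨s, hs, hsr.trans (le_of_oplus_left hrt)⟩

theorem multiple_mono {m n : ℕ} (h : m ≤ n) {s t : E} (hs : s ∈ multiple m a)
    (ht : t ∈ multiple n a) : s ≤ t := by
  obtain ⟨r, hr, hrt⟩ := exists_mem_multiple_of_le h ht
  rwa [Part.mem_unique hs hr]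

theorem oplus_mem_multiple {m n : ℕ} {s t r : E} (hs : s ∈ multiple m a)
    (ht : t ∈ multiple n a) (hr : r ∈ oplus s t) : r ∈ multiple (m + n) a := by
  induction n generalizing t r with
  | zero =>
    obtain rfl := Part.mem_some_iff.1 ht
    rwa [eq_of_oplus_zero hr]
  | succ n ih =>
    obtain ⟨q, hq, hqt⟩ := mem_multiple_succ.1 ht
    obtain ⟨p, hp, hpr⟩ := oplus_assoc' hqt hr
    exact mem_multiple_succ.2 ⟨p, ih hq hp, hpr⟩

theorem SigmaOrthocomplete.exists_not_dom (hσ : SigmaOrthocomplete E) (ha : a ≠ 0) :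
    ∃ n, ¬ (multiple n a).Dom := by
  by_contra! h
  obtain ⟨s, -, hs⟩ := hσ ℕ (fun _ => a) fun F => by
    rw [finSum_const]
    exact h _
  have hmul : ∀ n t, t ∈ multiple n a → t ≤ s := fun n t ht =>
    hs.1 ⟨Finset.range n, by rwa [finSum_const, Finset.card_range]⟩
  obtain ⟨r, hr⟩ := hmul 1 a mem_multiple_one
  -- With `s = r + a`, every `k a + a ≤ s` gives `k a ≤ r`; hence `s ≤ r` and `a = 0`.
  refine ha (eq_zero_of_oplus_le hr (hs.2 ?_))
  rintro t ⟨F, hF⟩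
  rw [finSum_const] at hF
  obtain ⟨q, hq⟩ := Part.dom_iff_mem.1 (h (F.card + 1))
  obtain ⟨p, hp, hpq⟩ := mem_multiple_succ.1 hq
  obtain rfl := Part.mem_unique hp hF
  exact le_of_oplus_le_oplus (oplus_comm hpq) (oplus_comm hr) (hmul _ _ hq)

theorem isotropicIndex_eq {n : ℕ} (hn : (multiple n a).Dom)
    (hn1 : ¬ (multiple (n + 1) a).Dom) : isotropicIndex a = n := by
  refine le_antisymm (iSup₂_le fun m hm => ?_) (le_iSup₂ (f := fun (k : ℕ) _ => (k : ℕ∞)) n hn)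
  by_contra hlt
  obtain ⟨t, ht⟩ := Part.dom_iff_mem.1 hm
  obtain ⟨s, hs, -⟩ := exists_mem_multiple_of_le (a := a)
    (Nat.succ_le_of_lt (by exact_mod_cast not_le.1 hlt : n < m)) ht
  exact hn1 (Part.dom_iff_mem.2 ⟨s, hs⟩)

theorem eq_zero_or_eq_of_le_isAtom {x : E} (ha : IsAtom a) (h : x ≤ a) : x = 0 ∨ x = a :=
  ha.le_iff.1 h

/-- RDP splits off a part below the last copy of `a`, which is `0` or `a`. -/
theorem RDP.exists_mem_multiple_of_le (hR : RDP E) (ha : IsAtom a) {n : ℕ} {x t : E}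
    (ht : t ∈ multiple n a) (hx : x ≤ t) : ∃ k, x ∈ multiple k a := by
  induction n generalizing x t with
  | zero =>
    obtain rfl := Part.mem_some_iff.1 ht
    exact ⟨0, le_zero_eq hx ▸ Part.mem_some 0⟩
  | succ n ih =>
    obtain ⟨s, hs, hst⟩ := mem_multiple_succ.1 ht
    obtain ⟨x₁, x₂, h, h1, h2⟩ := hR.exists_decomp hx hst
    obtain ⟨k, hk⟩ := ih hs h1
    obtain rfl | rfl := eq_zero_or_eq_of_le_isAtom ha h2
    · exact ⟨k, eq_of_oplus_zero h ▸ hk⟩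
    · exact ⟨k + 1, mem_multiple_succ.2 ⟨x₁, hk, h⟩⟩

theorem eq_zero_or_le_of_mem_multiple {k : ℕ} {x : E} (h : x ∈ multiple k a) :
    x = 0 ∨ a ≤ x := by
  cases k with
  | zero => exact Or.inl (Part.mem_some_iff.1 h)
  | succ k =>
    obtain ⟨s, -, hs⟩ := mem_multiple_succ.1 h
    exact Or.inr (le_of_oplus_right hs)

theorem eq_zero_or_eq_of_isAtom_of_le_multiple (hR : RDP E) {b : E} (ha : IsAtom a)
    (hb : IsAtom b) {n : ℕ} {t : E} (ht : t ∈ multiple n a) (h : b ≤ t) : a = b := by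
  obtain ⟨k, hk⟩ := hR.exists_mem_multiple_of_le ha ht h
  obtain h0 | h1 := eq_zero_or_le_of_mem_multiple hk
  · exact absurd h0 hb.1
  · exact (eq_zero_or_eq_of_le_isAtom hb h1).resolve_left ha.1

/-- `e` is the greatest multiple of the atom `a`. -/
structure IsMaxMultiple (a e : E) (n : ℕ) : Prop where
  isAtom : IsAtom a
  mem : e ∈ multiple n a
  not_dom : ¬ (multiple (n + 1) a).Dom

theorem SigmaOrthocomplete.exists_isMaxMultiple (hσ : SigmaOrthocomplete E) (ha : IsAtom a) :
    ∃ n e, IsMaxMultiple a e n := by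
  classical
  have h := hσ.exists_not_dom ha.1
  obtain ⟨m, hm⟩ : ∃ m, Nat.find h = m + 1 := Nat.exists_eq_succ_of_ne_zero fun h0 =>
    (h0 ▸ Nat.find_spec h) trivial
  have hdom : (multiple m a).Dom := not_not.1 (Nat.find_min h (by omega))
  exact ⟨m, _, ha, Part.get_mem hdom, hm ▸ Nat.find_spec h⟩

namespace IsMaxMultiple

variable {e : E} {n : ℕ}

theorem le_of_mem (h : IsMaxMultiple a e n) {k : ℕ} {t : E} (ht : t ∈ multiple k a) :
    k ≤ n := by
  by_contra hlt
  obtain ⟨s, hs, -⟩ := exists_mem_multiple_of_le (a := a) (not_le.1 hlt) ht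
  exact h.not_dom (Part.dom_iff_mem.2 ⟨s, hs⟩)

theorem le (h : IsMaxMultiple a e n) : a ≤ e :=
  multiple_mono (h.le_of_mem mem_multiple_one) mem_multiple_one h.mem

theorem not_le_compl (h : IsMaxMultiple a e n) : ¬ a ≤ compl e := fun hle => by
  obtain ⟨t, ht⟩ := exists_mem_of_le_compl hle
  exact h.not_dom (Part.dom_iff_mem.2 ⟨t, mem_multiple_succ.2 ⟨e, h.mem, ht⟩⟩)

theorem eq_zero_or_le (h : IsMaxMultiple a e n) (hR : RDP E) {x : E} (hx : x ≤ e) :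
    x = 0 ∨ a ≤ x := by
  obtain ⟨k, hk⟩ := hR.exists_mem_multiple_of_le h.isAtom h.mem hx
  exact eq_zero_or_le_of_mem_multiple hk

/-- A nonzero common lower bound of `t` and `e` would lie above `a`. -/
theorem le_compl_of_not_le (h : IsMaxMultiple a e n) (hR : RDP E) {t : E} (ht : ¬ a ≤ t) :
    t ≤ compl e := by
  refine hR.le_right_of_disjoint (le_top (a := t)) (oplus_compl e) fun w h1 h2 => ?_
  exact (h.eq_zero_or_le hR h2).resolve_right fun h3 => ht (h3.trans h1)

theorem isCentral (h : IsMaxMultiple a e n) (hR : RDP E) : IsCentral e := by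
  refine ⟨fun x y t hx hy ht => ?_, fun x y t hx hy ht => ?_, fun x => ?_⟩
  · obtain ⟨k, hk⟩ := hR.exists_mem_multiple_of_le h.isAtom h.mem hx
    obtain ⟨l, hl⟩ := hR.exists_mem_multiple_of_le h.isAtom h.mem hy
    have hkl := oplus_mem_multiple hk hl ht
    exact multiple_mono (h.le_of_mem hkl) hkl h.mem
  -- By RDP an atom below `x + y` lies below `x` or below `y`, here hence below `e'`, contradicting
  -- maximality.
  · refine h.le_compl_of_not_le hR fun hat => h.not_le_compl ?_
    obtain ⟨p, q, hpq, hp, hq⟩ := hR.exists_decomp hat ht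
    obtain rfl | rfl := eq_zero_or_eq_of_le_isAtom h.isAtom (le_of_oplus_left hpq)
    · rw [eq_of_zero_oplus hpq]
      exact hq.trans hy
    · exact hp.trans hx
  · obtain ⟨x₁, x₂, hx, h1, h2⟩ := hR.exists_decomp (le_top (a := x)) (oplus_compl e)
    exact ⟨x₁, x₂, h1, h2, hx⟩

theorem isAtom_center (h : IsMaxMultiple a e n) (hR : RDP E) :
    IsAtom (⟨e, h.isCentral hR⟩ : center E) := by
  refine ⟨fun h0 => ?_, ?_⟩
  · have he : e = 0 := congrArg Subtype.val h0
    exact h.isAtom.1 (le_zero_eq (he ▸ h.le))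
  · rintro ⟨z, hz⟩ hlt
    have hle : z ≤ e := hlt.le
    obtain h0 | haz := h.eq_zero_or_le hR hle
    · exact Subtype.ext h0
    -- If `e = r + z` with `r ≠ 0`, then `a` lies below both `z` and `r ≤ z'`.
    · obtain ⟨r, hr⟩ := hle
      obtain h0 | har := h.eq_zero_or_le hR (le_of_oplus_left hr)
      · subst h0
        exact absurd (Subtype.ext (eq_of_zero_oplus hr).symm) hlt.ne
      · exact absurd (hz.1.eq_zero haz (har.trans (le_compl_of_mem (oplus_comm hr))))
          h.isAtom.1

theorem finite_Icc (h : IsMaxMultiple a e n) (hR : RDP E) : (Set.Icc 0 e).Finite := by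
  refine Set.Finite.subset (s := ⋃ k ∈ Set.Iic n, {t | t ∈ multiple k a})
    ((Set.finite_Iic n).biUnion fun k _ => Set.Subsingleton.finite fun s hs t ht =>
      Part.mem_unique hs ht) fun x hx => ?_
  obtain ⟨k, hk⟩ := hR.exists_mem_multiple_of_le h.isAtom h.mem hx.2
  exact Set.mem_biUnion (h.le_of_mem hk) hk

theorem isChain_Icc (h : IsMaxMultiple a e n) (hR : RDP E) :
    IsChain (· ≤ ·) (Set.Icc 0 e) := by
  intro x hx y hy _
  obtain ⟨k, hk⟩ := hR.exists_mem_multiple_of_le h.isAtom h.mem hx.2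
  obtain ⟨l, hl⟩ := hR.exists_mem_multiple_of_le h.isAtom h.mem hy.2
  exact (le_total k l).imp (fun hkl => multiple_mono hkl hk hl) fun hkl => multiple_mono hkl hl hk

theorem le_compl_of_ne (h : IsMaxMultiple a e n) (hR : RDP E) {b f : E} {m : ℕ}
    (h' : IsMaxMultiple b f m) (hab : a ≠ b) : f ≤ compl e :=
  h.le_compl_of_not_le hR fun hle =>
    hab (eq_zero_or_eq_of_isAtom_of_le_multiple hR h'.isAtom h.isAtom h'.mem hle).symm

end IsMaxMultiple

end Multiples

/-! ### Decomposition along a central partition -/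

section CentralFamily

variable {E : Type u} [EffectAlgebra E] {I : Type v}

/-- A family of pairwise orthogonal central elements such that only `0` is orthogonal to all
of them. -/
structure IsCentralPartition (e : I → E) : Prop where
  isCentral : ∀ i, IsCentral (e i)
  le_compl : ∀ i j, i ≠ j → e j ≤ compl (e i)
  eq_zero : ∀ x, (∀ i, x ≤ compl (e i)) → x = 0

namespace IsCentralPartition

variable {e : I → E}

/-- Orthogonality to the remaining `e j` is carried along the induction so that the next term can be
added. -/
theorem exists_finSum (he : IsCentralPartition e) {u : I → E} (hu : ∀ i, u i ≤ e i)
    (F : Finset I) : ∃ t ∈ finSum u F, ∀ j ∉ F, t ≤ compl (e j) := by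
  classical
  induction F using Finset.induction_on with
  | empty => exact ⟨0, Part.mem_some 0, fun j _ => zero_le' _⟩
  | insert i F hi ih =>
    obtain ⟨s, hs, hsF⟩ := ih
    obtain ⟨t, ht⟩ := exists_mem_of_le_compl ((hu i).trans (le_compl_symm (hsF i hi)))
    refine ⟨t, (mem_finSum_insert hi).2 ⟨s, hs, oplus_comm ht⟩, fun j hj => ?_⟩
    rw [Finset.mem_insert, not_or] at hj
    exact (he.isCentral j).2.1 (hsF j hj.2) ((hu i).trans (he.le_compl j i hj.1)) ht

theorem finSum_le (he : IsCentralPartition e) (hR : RDP E) {u : I → E} (hu : ∀ i, u i ≤ e i)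
    {x : E} (hx : ∀ i, u i ≤ x) {F : Finset I} {t : E} (ht : t ∈ finSum u F) : t ≤ x := by
  classical
  induction F using Finset.induction_on generalizing t with
  | empty => exact Part.mem_some_iff.1 ht ▸ zero_le' x
  | insert i F hi ih =>
    obtain ⟨s, hs, hst⟩ := (mem_finSum_insert hi).1 ht
    obtain ⟨s', hs', hle⟩ := he.exists_finSum hu F
    obtain rfl := Part.mem_unique hs hs'
    exact (he.isCentral i).1.oplus_le hR (hu i) (hle i hi) (hx i) (ih hs) hst

/-- Since the terms lie below orthogonal central elements, any upper bound of them bounds their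
finite sums. -/
theorem isOrthoSum_iff_isLUB (he : IsCentralPartition e) (hR : RDP E) {u : I → E}
    (hu : ∀ i, u i ≤ e i) {s : E} : IsOrthoSum u s ↔ IsLUB (Set.range u) s := by
  have horth : Orthogonal u := fun F => by
    obtain ⟨t, ht, -⟩ := he.exists_finSum hu F
    exact Part.dom_iff_mem.2 ⟨t, ht⟩
  have hub : upperBounds {t : E | ∃ F : Finset I, t ∈ finSum u F} =
      upperBounds (Set.range u) := by
    ext x
    constructor
    · rintro hx _ ⟨i, rfl⟩
      exact hx ⟨{i}, finSum_singleton u i⟩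
    · rintro hx t ⟨F, hF⟩
      exact he.finSum_le hR hu (fun i => hx ⟨i, rfl⟩) hF
  rw [IsOrthoSum, and_iff_right horth, IsLUB, IsLUB, hub]

theorem exists_isLUB [Countable I] (he : IsCentralPartition e) (hR : RDP E)
    (hσ : SigmaOrthocomplete E) {u : I → E} (hu : ∀ i, u i ≤ e i) :
    ∃ s, IsLUB (Set.range u) s := by
  obtain ⟨s, hs⟩ := hσ.exists_isOrthoSum u fun F => by
    obtain ⟨t, ht, -⟩ := he.exists_finSum hu F
    exact Part.dom_iff_mem.2 ⟨t, ht⟩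
  exact ⟨s, (he.isOrthoSum_iff_isLUB hR hu).1 hs⟩

/-- The component of `x` in `E[0, e i]`. -/
noncomputable def comp (he : IsCentralPartition e) (i : I) (x : E) : E :=
  (he.isCentral i).meet x

theorem comp_le (he : IsCentralPartition e) (i : I) (x : E) : he.comp i x ≤ e i :=
  (he.isCentral i).meet_le_right x

theorem isLUB_comp [Countable I] (he : IsCentralPartition e) (hR : RDP E)
    (hσ : SigmaOrthocomplete E) (y : E) : IsLUB (Set.range fun i => he.comp i y) y := by
  obtain ⟨s, hs⟩ := he.exists_isLUB hR hσ (u := fun i => he.comp i y) fun i => he.comp_le i y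
  have hsy : s ≤ y := hs.2 (by
    rintro _ ⟨i, rfl⟩
    exact (he.isCentral i).meet_le_left y)
  obtain ⟨r, hr⟩ := hsy
  -- In `y = r + s`, `s` already contains every component of `y`, so by additivity all components of
  -- `r` vanish.
  have hr0 : r = 0 := he.eq_zero r fun i => by
    obtain ⟨r₂, h1, h2, h⟩ := (he.isCentral i).exists_meet r
    have hy := (he.isCentral i).meet_oplus hR hr
    have hle : (he.isCentral i).meet y ≤ (he.isCentral i).meet s :=
      (he.isCentral i).le_meet hR (hs.1 ⟨i, rfl⟩) (he.comp_le i y)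
    rw [eq_zero_of_oplus_le (oplus_comm hy) hle] at h
    rwa [eq_of_zero_oplus h]
  subst hr0
  rwa [← eq_of_zero_oplus hr] at hs

theorem le_of_comp_le [Countable I] (he : IsCentralPartition e) (hR : RDP E)
    (hσ : SigmaOrthocomplete E) {x y : E} (h : ∀ i, he.comp i x ≤ he.comp i y) : x ≤ y :=
  (he.isLUB_comp hR hσ x).2 (by
    rintro _ ⟨i, rfl⟩
    exact (h i).trans ((he.isCentral i).meet_le_left y))

theorem comp_eq_of_isLUB (he : IsCentralPartition e) (hR : RDP E) {u : I → E}
    (hu : ∀ i, u i ≤ e i) {s : E} (hs : IsLUB (Set.range u) s) (j : I) : he.comp j s = u j := by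
  obtain ⟨r, hr⟩ := hs.1 ⟨j, rfl⟩
  obtain ⟨r₂, h1, h2, h⟩ := (he.isCentral j).exists_meet r
  obtain ⟨p, hp, hps⟩ := oplus_assoc h hr
  -- Here `s = r₁ + p` with `r₁ ≤ e j` the component of `r`. As `p` still bounds every `u i`, `r₁ =
  -- 0`.
  have hle : s ≤ p := hs.2 (by
    rintro _ ⟨i, rfl⟩
    obtain rfl | hij := eq_or_ne j i
    · exact le_of_oplus_right hp
    · refine hR.le_right_of_disjoint (hs.1 ⟨i, rfl⟩) hps fun w hw1 hw2 => ?_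
      exact (he.isCentral j).1.eq_zero (hw2.trans h1)
        (hw1.trans ((hu i).trans (he.le_compl j i hij))))
  have h0 := eq_zero_of_oplus_le (oplus_comm hps) hle
  rw [h0] at hps
  rw [eq_of_zero_oplus hps]
  exact (he.isCentral j).meet_eq hR (hu j) h2 (oplus_comm hp)

theorem comp_ext [Countable I] (he : IsCentralPartition e) (hR : RDP E)
    (hσ : SigmaOrthocomplete E) {x y : E} (h : ∀ i, he.comp i x = he.comp i y) : x = y :=
  le_antisymm (he.le_of_comp_le hR hσ fun i => (h i).le)
    (he.le_of_comp_le hR hσ fun i => (h i).ge)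

theorem exists_comp_eq [Countable I] (he : IsCentralPartition e) (hR : RDP E)
    (hσ : SigmaOrthocomplete E) {u : I → E} (hu : ∀ i, u i ≤ e i) :
    ∃ s, ∀ i, he.comp i s = u i := by
  obtain ⟨s, hs⟩ := he.exists_isLUB hR hσ hu
  exact ⟨s, he.comp_eq_of_isLUB hR hu hs⟩

theorem mem_oplus_iff [Countable I] (he : IsCentralPartition e) (hR : RDP E)
    (hσ : SigmaOrthocomplete E) {x y t : E} :
    t ∈ oplus x y ↔ ∀ i, he.comp i t ∈ oplus (he.comp i x) (he.comp i y) := by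
  refine ⟨fun h i => (he.isCentral i).meet_oplus hR h, fun h => ?_⟩
  obtain ⟨r, hr⟩ := he.le_of_comp_le hR hσ fun i => le_of_oplus_left (h i)
  -- Cancellation in each coordinate identifies the remainder `r` of `x` in `t`.
  have hry : r = y := he.comp_ext hR hσ fun i =>
    oplus_cancel ((he.isCentral i).meet_oplus hR (oplus_comm hr)) (h i)
  exact hry ▸ oplus_comm hr

/-- The component of `x` as an element of the interval `E[0, e i]`. -/
noncomputable def toInterval (he : IsCentralPartition e) (i : I) (x : E) : Interval (e i) :=
  ⟨he.comp i x, zero_le' _, he.comp_le i x⟩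

/-- The isomorphism of `E` with the product of the intervals below a central partition. -/
noncomputable def iso [Countable I] (he : IsCentralPartition e) (hR : RDP E)
    (hσ : SigmaOrthocomplete E) : Iso E (Product fun i => Interval (e i)) where
  toEquiv := Equiv.ofBijective
    (fun x i => he.toInterval i x)
    ⟨fun x y h => he.comp_ext hR hσ fun i => congrArg Interval.val (congrFun h i), fun u => by
      obtain ⟨s, hs⟩ := he.exists_comp_eq hR hσ (u := fun i => (u i).val) fun i => (u i).val_le
      exact ⟨s, funext fun i => Interval.ext (hs i)⟩⟩
  map_zero := funext fun i => Interval.ext (le_zero_eq ((he.isCentral i).meet_le_left 0))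
  map_one := funext fun i => Interval.ext (le_antisymm (he.comp_le i 1)
    ((he.isCentral i).le_meet hR (le_top (a := e i)) le_rfl))
  map_oplus x y t := by
    rw [he.mem_oplus_iff hR hσ, Product.mem_oplus_iff]
    exact forall_congr' fun i => (Interval.mem_oplus_iff (x := he.toInterval i x)
      (y := he.toInterval i y) (t := he.toInterval i t)).symm

theorem exists_isLUB_of_finite_chains [Countable I] (he : IsCentralPartition e) (hR : RDP E)
    (hσ : SigmaOrthocomplete E) (hfin : ∀ i, (Set.Icc 0 (e i)).Finite)
    (hchain : ∀ i, IsChain (· ≤ ·) (Set.Icc 0 (e i))) (S : Set E) : ∃ s, IsLUB S s := by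
  -- In a finite chain a maximal element is greatest; the empty set has supremum `0`.
  have hsup : ∀ i, ∃ m ≤ e i, IsLUB (he.comp i '' S) m := by
    intro i
    obtain rfl | hS := S.eq_empty_or_nonempty
    · refine ⟨0, zero_le' _, ?_⟩
      rw [Set.image_empty, isLUB_empty_iff]
      exact zero_le'
    · have hsub : he.comp i '' S ⊆ Set.Icc 0 (e i) := by
        rintro _ ⟨x, -, rfl⟩
        exact ⟨zero_le' _, he.comp_le i x⟩
      obtain ⟨m, hm⟩ := ((hfin i).subset hsub).exists_maximal (hS.image _)
      refine ⟨m, (hsub hm.prop).2, IsGreatest.isLUB ⟨hm.prop, fun x hx => ?_⟩⟩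
      obtain h | h := (hchain i).total (hsub hx) (hsub hm.prop)
      · exact h
      · exact hm.le_of_ge hx h
  choose u hu hlub using hsup
  obtain ⟨s, hs⟩ := he.exists_comp_eq hR hσ hu
  refine ⟨s, fun x hx => he.le_of_comp_le hR hσ fun i => ?_, fun b hb =>
    he.le_of_comp_le hR hσ fun i => ?_⟩
  · rw [hs i]
    exact (hlub i).1 ⟨x, hx, rfl⟩
  · rw [hs i]
    refine (hlub i).2 ?_
    rintro _ ⟨x, hx, rfl⟩
    exact (he.isCentral i).meet_mono hR (hb hx)

end IsCentralPartition

end CentralFamily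

/-! ### Conclusion -/

theorem isSigmaCompleteMVEffectAlgebra_of_isLUB {E : Type u} [EffectAlgebra E] (hR : RDP E)
    (h : ∀ S : Set E, ∃ s, IsLUB S s) : IsSigmaCompleteMVEffectAlgebra E := by
  have h' : ∀ S : Set E, ∃ m, IsGLB S m := fun S => by
    obtain ⟨m, hm⟩ := h (lowerBounds S)
    exact ⟨m, isLUB_lowerBounds.1 hm⟩
  exact ⟨⟨fun a b => ⟨h _, h' _⟩, hR.compatible⟩, fun S _ => ⟨h S, h' S⟩⟩

end EffectAlgebra

open EffectAlgebra in
theorem theorem4p11 {E : Type u} [EffectAlgebra E] (hσ : SigmaOrthocomplete E)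
    (hatomic : IsAtomic E) (hRDP : RDP E) {I : Type v} (hI : Countable I) (a : I → E)
    (ha : Function.Injective a) (hA : Set.range a = {x : E | IsAtom x}) :
    ∃ (n : I → ℕ) (e : I → E),
      (∀ i, isotropicIndex (a i) = (n i : ℕ∞) ∧ e i ∈ multiple (n i) (a i)) ∧
      (∀ i, ∃ h : e i ∈ center E, IsAtom (⟨e i, h⟩ : center E)) ∧
      (∀ y : E, ∃ m : I → E, (∀ i, IsGLB {y, e i} (m i)) ∧ IsOrthoSum m y) ∧
      (∀ i, (Set.Icc 0 (e i)).Finite ∧ IsChain (· ≤ ·) (Set.Icc 0 (e i))) ∧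
      Nonempty (Iso E (Product fun i => Interval (e i))) ∧
      IsSigmaCompleteMVEffectAlgebra E := by
  have hatom : ∀ i, IsAtom (a i) := fun i => hA.subset ⟨i, rfl⟩
  choose n e hne using fun i => hσ.exists_isMaxMultiple (hatom i)
  have he : IsCentralPartition e :=
    { isCentral := fun i => (hne i).isCentral hRDP
      le_compl := fun i j hij => (hne i).le_compl_of_ne hRDP (hne j) (ha.ne hij)
      eq_zero := fun x hx => by
        obtain h0 | ⟨b, hb, hbx⟩ := hatomic.eq_bot_or_exists_atom_le x
        · exact h0
        · obtain ⟨i, rfl⟩ := hA.superset hb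
          -- An atom `a i ≤ x` would lie below `(e i)'`, allowing one more multiple.
          exact absurd (hbx.trans (hx i)) (hne i).not_le_compl }
  refine ⟨n, e, fun i => ⟨isotropicIndex_eq (Part.dom_iff_mem.2 ⟨_, (hne i).mem⟩)
    (hne i).not_dom, (hne i).mem⟩, fun i => ⟨_, (hne i).isAtom_center hRDP⟩, fun y =>
    ⟨fun i => he.comp i y, fun i => (he.isCentral i).isGLB_meet hRDP y,
      (he.isOrthoSum_iff_isLUB hRDP fun i => he.comp_le i y).2 (he.isLUB_comp hRDP hσ y)⟩,
    fun i => ⟨(hne i).finite_Icc hRDP, (hne i).isChain_Icc hRDP⟩, ⟨he.iso hRDP hσ⟩, ?_⟩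
  exact isSigmaCompleteMVEffectAlgebra_of_isLUB hRDP (he.exists_isLUB_of_finite_chains hRDP hσ
    (fun i => (hne i).finite_Icc hRDP) fun i => (hne i).isChain_Icc hRDP)
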